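/- Let $0\le k<d$ be integers. All balls $B(x,\rho)$ in $\mathbb{R}^d$ are closed and Euclidean, and for an affine subspace $\mathcal L$ we write $\mathcal L^{(\varepsilon)}=\{x:\operatorname{dist}(x,\mathcal L)<\varepsilon\}$. **The game.** For a closed set $K\subset\mathbb{R}^d$ and $0<\beta<1$, in the $k$-dimensional $\beta$-absolute game on $K$ Bob first chooses a ball $B_1=B(x_1,\rho_1)$ with $x_1\in K$, $\rho_1>0$. After Bob has chosen $B_i=B(x_i,\rho_i)$, Alice chooses a $k$-dimensional affine subspace $\mathcal L_i$ and $0<\varepsilon_i\le\beta$, and then Bob chooses $B_{i+1}=B(x_{i+1},\rho_{i+1})$ with $x_{i+1}\in K$, $\rho_{i+1}\ge\beta\rho_i$ and $B_{i+1}\subset B_i\setminus\mathcal L_i^{(\varepsilon_i\rho_i)}$. If at some stage Bob has no legal choice of $B_{i+1}$, Bob wins; otherwise Alice wins if and only if $\bigcap_i B_i\cap S\neq\varnothing$. A set $S\subset\mathbb{R}^d$ is *$k$-dimensionally $\beta$-absolute winning on $K$* if Alice has a winning strategy. It is *$k$-dimensionally absolute winning* if it is $k$-dimensionally $\beta$-absolute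 winning on $\mathbb{R}^d$ for every $0<\beta<1/3$, and *$k$-dimensionally absolute winning on $K$* if there is $\beta_0>0$ such that it is $k$-dimensionally $\beta$-absolute winning on $K$ for every $0<\beta\le\beta_0$. **Diffuse sets.** A closed set $K\subset\mathbb{R}^d$ is *$k$-dimensionally diffuse* if there are $0<\beta<1$ and $\rho_K>0$ such that for all $0<\rho\le\rho_K$, all $x\in K$ and all $k$-dimensional affine subspaces $\mathcal L$ one has $K\cap B(x,\rho)\setminus\mathcal L^{(\beta\rho)}\neq\varnothing$. **Theorem.** Let $S\subset\mathbb{R}^d$ be $k$-dimensionally absolute winning, let $U\subset\mathbb{R}^d$ be open, and let $K\subset\mathbb{R}^d$ be $k$-dimensionally diffuse. 1. For every $C^1$ map $f:U\to\mathbb{R}^d$ whose derivative is invertible at every point of $U$, the set $f^{-1}(S)\cup U^c$ is $k$-dimensionally absolute winning on $K$. 2. If $U\cap K\neq\varnothing$, then for every sequence $(f_i)_{i\ge1}$ of $C^1$ diffeomorphisms of $U$ onto (possibly different) open subsets of $\mathbb{R}^d$, the set $\bigcap_{i=1}^\infty f_i^{-1}(S)\cap K$ has positive Hausdorff dimension.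 In particular (the case $k=d-1$), 2. holds whenever $S$ is hyperplane absolute winning and $K$ is hyperplane diffuse. -/

import Mathlib

namespace AbsoluteGame

/-- A move of Bob: the centre and the radius of a closed ball in `ℝ^d`. -/
abbrev BobMove (d : ℕ) : Type := EuclideanSpace ℝ (Fin d) × ℝ

/-- The closed ball chosen by Bob. -/
def BobMove.ball {d : ℕ} (b : BobMove d) : Set (EuclideanSpace ℝ (Fin d)) :=
  Metric.closedBall b.1 b.2

/-- A move of Alice in the `k`-dimensional `β`-absolute game: a (nonempty) affine subspace of
dimension `k` and a relative width `0 < ε ≤ β`. -/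
structure AliceMove (d k : ℕ) (β : ℝ) where
  plane : AffineSubspace ℝ (EuclideanSpace ℝ (Fin d))
  plane_nonempty : (plane : Set (EuclideanSpace ℝ (Fin d))).Nonempty
  finrank_direction : Module.finrank ℝ plane.direction = k
  width : ℝ
  width_pos : 0 < width
  width_le : width ≤ β

/-- The set removed by Alice after Bob's move `b`: the (open) neighbourhood of her affine subspace
of radius `ε` times the radius of Bob's ball. -/
def AliceMove.removed {d k : ℕ} {β : ℝ} (a : AliceMove d k β) (b : BobMove d) :
    Set (EuclideanSpace ℝ (Fin d)) :=
  Metric.thickening (a.width * b.2) (a.plane : Set (EuclideanSpace ℝ (Fin d)))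

/-- Legal opening moves of Bob in the game played on `K`. -/
def LegalStart {d : ℕ} (K : Set (EuclideanSpace ℝ (Fin d))) (b : BobMove d) : Prop :=
  b.1 ∈ K ∧ 0 < b.2

/-- `b'` is a legal answer of Bob, in the game played on `K`, to Alice's move `a` that followed
Bob's move `b`. -/
def LegalNext {d k : ℕ} {β : ℝ} (K : Set (EuclideanSpace ℝ (Fin d)))
    (b : BobMove d) (a : AliceMove d k β) (b' : BobMove d) : Prop :=
  b'.1 ∈ K ∧ 0 < b'.2 ∧ β * b.2 ≤ b'.2 ∧ b'.ball ⊆ b.ball \ a.removed b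

/-- A strategy of Alice: her `n`-th move as a function of Bob's moves `0, …, n`. -/
abbrev Strategy (d k : ℕ) (β : ℝ) : Type :=
  (n : ℕ) → (Fin (n + 1) → BobMove d) → AliceMove d k β

/-- Alice's `n`-th answer under the strategy `σ` when Bob's moves are `b 0, b 1, …`. -/
def Strategy.answer {d k : ℕ} {β : ℝ} (σ : Strategy d k β) (b : ℕ → BobMove d) (n : ℕ) :
    AliceMove d k β :=
  σ n fun i => b i

/-- Bob's moves `b 0, …, b n` are legal when Alice plays by `σ` (the later values of `b` are
irrelevant). -/
def LegalUpTo {d k : ℕ} {β : ℝ} (K : Set (EuclideanSpace ℝ (Fin d))) (σ : Strategy d k β)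
    (b : ℕ → BobMove d) (n : ℕ) : Prop :=
  LegalStart K (b 0) ∧ ∀ i < n, LegalNext K (b i) (σ.answer b i) (b (i + 1))

/-- `σ` is winning for Alice with target `S` in the game on `K`: Bob always has a legal next move
(a position in which he has none is lost for Alice), and in every infinite play the intersection of
Bob's balls meets `S`. -/
def Strategy.IsWinning {d k : ℕ} {β : ℝ} (σ : Strategy d k β)
    (S K : Set (EuclideanSpace ℝ (Fin d))) : Prop :=
  (∀ (b : ℕ → BobMove d) (n : ℕ), LegalUpTo K σ b n →
    ∃ b' : BobMove d, LegalNext K (b n) (σ.answer b n) b') ∧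
  ∀ b : ℕ → BobMove d, (∀ n, LegalUpTo K σ b n) → ((⋂ i, (b i).ball) ∩ S).Nonempty

/-- `S` is `k`-dimensionally `β`-absolute winning on `K`. -/
def IsBetaWinningOn {d : ℕ} (k : ℕ) (β : ℝ) (S K : Set (EuclideanSpace ℝ (Fin d))) : Prop :=
  ∃ σ : Strategy d k β, σ.IsWinning S K

/-- `S ⊆ ℝ^d` is `k`-dimensionally absolute winning: it is `k`-dimensionally `β`-absolute winning
(on `ℝ^d`) for every `0 < β < 1/3`. -/
def IsAbsoluteWinning {d : ℕ} (k : ℕ) (S : Set (EuclideanSpace ℝ (Fin d))) : Prop :=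
  ∀ β : ℝ, 0 < β → β < 1 / 3 → IsBetaWinningOn k β S Set.univ

/-- `S` is `k`-dimensionally absolute winning on `K`: it is `k`-dimensionally `β`-absolute winning
on `K` for all sufficiently small `β > 0`. -/
def IsAbsoluteWinningOn {d : ℕ} (k : ℕ) (S K : Set (EuclideanSpace ℝ (Fin d))) : Prop :=
  ∃ β₀ : ℝ, 0 < β₀ ∧ ∀ β : ℝ, 0 < β → β ≤ β₀ → IsBetaWinningOn k β S K

/-- `K` is `k`-dimensionally `β`-diffuse. -/
def IsBetaDiffuse {d : ℕ} (k : ℕ) (β : ℝ) (K : Set (EuclideanSpace ℝ (Fin d))) : Prop :=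
  IsClosed K ∧ ∃ ρK : ℝ, 0 < ρK ∧ ∀ ρ : ℝ, 0 < ρ → ρ ≤ ρK → ∀ x ∈ K,
    ∀ L : AffineSubspace ℝ (EuclideanSpace ℝ (Fin d)),
      (L : Set (EuclideanSpace ℝ (Fin d))).Nonempty → Module.finrank ℝ L.direction = k →
        ∃ x' ∈ K, x' ∈ Metric.closedBall x ρ \
          Metric.thickening (β * ρ) (L : Set (EuclideanSpace ℝ (Fin d)))

/-- `K` is `k`-dimensionally diffuse. -/
def IsDiffuse {d : ℕ} (k : ℕ) (K : Set (EuclideanSpace ℝ (Fin d))) : Prop :=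
  ∃ β : ℝ, 0 < β ∧ β < 1 ∧ IsBetaDiffuse k β K

/-- `f` is a nonsingular `C¹` map on `U` (used for open `U`). -/
def IsNonsingularC1On {d : ℕ} (f : EuclideanSpace ℝ (Fin d) → EuclideanSpace ℝ (Fin d))
    (U : Set (EuclideanSpace ℝ (Fin d))) : Prop :=
  ContDiffOn ℝ 1 f U ∧ ∀ x ∈ U, (fderiv ℝ f x).IsInvertible

/-- `f` restricts to a `C¹` diffeomorphism of `U` onto an open subset of `ℝ^d` (used for open
`U`). -/
def IsC1DiffeoOntoOpen {d : ℕ} (f : EuclideanSpace ℝ (Fin d) → EuclideanSpace ℝ (Fin d))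
    (U : Set (EuclideanSpace ℝ (Fin d))) : Prop :=
  ContDiffOn ℝ 1 f U ∧ IsOpen (f '' U) ∧
    ∃ g : EuclideanSpace ℝ (Fin d) → EuclideanSpace ℝ (Fin d),
      ContDiffOn ℝ 1 g (f '' U) ∧ Set.LeftInvOn g f U

end AbsoluteGame

/-! Alice's task is reduced to a form that does not mention `K`: `Strategy.WinsSmall`. Only plays
whose radii tend to zero are considered, Bob's centres are arbitrary, and Alice's moves count only
once the balls have radius at most `r`. Diffuseness of `K` is then needed only to supply Bob with
moves.

For one map (`exists_winsSmall_preimage`), Alice waits until Bob's ball lies in `U` and is so small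
that `f` is nearly a linear isomorphism `A` on it. From then on she simulates a game for `S` in the
image, with balls enlarged by a Lipschitz constant. She pulls the simulated planes back by `A`,
using only times at which the radius has shrunk enough to absorb both the linearization error and
the size of the ball. If she waits forever, the limit point is outside `U`. Countably many targets
are handled by interleaving disjoint arithmetic progressions of times (`exists_winsSmall_iInter`); a
sparser progression only means a smaller parameter, and every parameter is available.

On a diffuse set Bob always has two well-separated legal moves (`exists_separated_legalNext`).
Letting him choose freely between them against a `WinsSmall` strategy gives a Cantor set inside the
target and `K`, of positive dimension (`dimH_inter_pos_of_winsSmall`); this is the second claim.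
Applied to `ℝ^d` itself, it shows that the target is dense, which settles the plays in the first
claim whose radii do not tend to zero. -/

open Filter Topology

namespace AbsoluteGame

variable {d k : ℕ} {β : ℝ}

/-! ### Strategies and nested plays. -/

/-- The strategy given by a rule for whole plays; it is faithful to rules that do not look into
the future. -/
def Strategy.ofRule (α : (ℕ → BobMove d) → ℕ → AliceMove d k β) : Strategy d k β :=
  fun n h => α (fun i => h ⟨min i n, Nat.lt_succ_of_le (min_le_right i n)⟩) n

theorem Strategy.answer_ofRule {α : (ℕ → BobMove d) → ℕ → AliceMove d k β}
    (hα : ∀ b b' n, (∀ i ≤ n, b i = b' i) → α b n = α b' n) (b : ℕ → BobMove d) (n : ℕ) :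
    (Strategy.ofRule α).answer b n = α b n := by
  refine hα _ _ _ fun i hi => ?_
  simp [min_eq_left hi]

theorem Strategy.answer_congr (σ : Strategy d k β) {b b' : ℕ → BobMove d} {n : ℕ}
    (h : ∀ i ≤ n, b i = b' i) : σ.answer b n = σ.answer b' n := by
  unfold Strategy.answer
  congr 1
  funext i
  exact h i (Nat.le_of_lt_succ i.2)

/-- An infinite nested sequence of balls whose radii shrink at most by the factor `β` at each
step. -/
structure IsPlay (β : ℝ) (b : ℕ → BobMove d) : Prop where
  radius_pos : ∀ n, 0 < (b n).2
  mul_le_radius_succ : ∀ n, β * (b n).2 ≤ (b (n + 1)).2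
  dist_add_radius_le : ∀ n, dist (b (n + 1)).1 (b n).1 + (b (n + 1)).2 ≤ (b n).2

namespace IsPlay

variable {b : ℕ → BobMove d}

theorem dist_add_radius_le_of_le (hb : IsPlay β b) {m n : ℕ} (h : m ≤ n) :
    dist (b n).1 (b m).1 + (b n).2 ≤ (b m).2 := by
  induction n, h using Nat.le_induction with
  | base => simp
  | succ n _ ih =>
    have h1 := hb.dist_add_radius_le n
    have h2 := dist_triangle (b (n + 1)).1 (b n).1 (b m).1
    linarith

theorem ball_subset (hb : IsPlay β b) {m n : ℕ} (h : m ≤ n) : (b n).ball ⊆ (b m).ball := by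
  apply Metric.closedBall_subset_closedBall'
  linarith [hb.dist_add_radius_le_of_le h]

theorem radius_le (hb : IsPlay β b) {m n : ℕ} (h : m ≤ n) : (b n).2 ≤ (b m).2 := by
  have := hb.dist_add_radius_le_of_le h
  linarith [dist_nonneg (x := (b n).1) (y := (b m).1)]

theorem pow_mul_le_radius (hb : IsPlay β b) (hβ : 0 ≤ β) (n s : ℕ) :
    β ^ s * (b n).2 ≤ (b (n + s)).2 := by
  induction s with
  | zero => simp
  | succ s ih =>
    calc β ^ (s + 1) * (b n).2 = β * (β ^ s * (b n).2) := by ring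
      _ ≤ β * (b (n + s)).2 := by gcongr
      _ ≤ _ := hb.mul_le_radius_succ _

/-- Nested balls with radii at least `c` have a common ball of radius `c`. -/
theorem exists_closedBall_subset (hb : IsPlay β b) {c : ℝ} (hc : ∀ n, c ≤ (b n).2) :
    ∃ y, ∀ n, Metric.closedBall y c ⊆ (b n).ball := by
  -- Decreasing every radius by `c` preserves nesting, and a common point of the smaller balls is
  -- the required centre.
  have hne := IsCompact.nonempty_iInter_of_sequence_nonempty_isCompact_isClosed
    (fun n => Metric.closedBall (b n).1 ((b n).2 - c))
    (fun n => Metric.closedBall_subset_closedBall' (by linarith [hb.dist_add_radius_le n]))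
    (fun n => Metric.nonempty_closedBall.2 (by linarith [hc n]))
    (isCompact_closedBall _ _) (fun n => Metric.isClosed_closedBall)
  obtain ⟨y, hy⟩ := hne
  refine ⟨y, fun n => Metric.closedBall_subset_closedBall' ?_⟩
  have := Set.mem_iInter.1 hy n
  rw [Metric.mem_closedBall] at this
  linarith

end IsPlay

/-- `σ` wins against shrinking plays in which Bob has to respect Alice's choices only as long as
his balls have radius at most `r`. -/
def Strategy.WinsSmall (σ : Strategy d k β) (r : ℝ)
    (T : Set (EuclideanSpace ℝ (Fin d))) : Prop :=
  ∀ b : ℕ → BobMove d, IsPlay β b → Tendsto (fun n => (b n).2) atTop (𝓝 0) →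
    (∀ n, (b n).2 ≤ r → Disjoint (b (n + 1)).ball ((σ.answer b n).removed (b n))) →
      ∀ x, (∀ n, x ∈ (b n).ball) → x ∈ T

/-! ### Playing along a subsequence of times -/

open Classical in
/-- The memory of a player who starts recording Bob's moves at the first one that satisfies `G`,
and from then on records a move when its radius is at most `δ` (of the first recorded move) times
the radius of the last recorded one. -/
noncomputable def record (G : BobMove d → Prop) (δ : BobMove d → ℝ) (b : ℕ → BobMove d) :
    ℕ → Option (ℕ × (ℕ → BobMove d))
  | 0 => if G (b 0) then some (0, fun _ => b 0) else none
  | n + 1 =>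
    match record G δ b n with
    | none => if G (b (n + 1)) then some (0, fun _ => b (n + 1)) else none
    | some (j, c) =>
      if (b (n + 1)).2 ≤ δ (c 0) * (c j).2 then some (j + 1, Function.update c (j + 1) (b (n + 1)))
      else some (j, c)

theorem record_congr {G : BobMove d → Prop} {δ : BobMove d → ℝ} {b b' : ℕ → BobMove d} {n : ℕ}
    (h : ∀ i ≤ n, b i = b' i) : record G δ b n = record G δ b' n := by
  induction n with
  | zero => rw [record, record, h 0 le_rfl]
  | succ n ih =>
    rw [record, record, ih fun i hi => h i (hi.trans n.le_succ), h (n + 1) le_rfl]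

/-- Any strategy can be played along a subsequence of times, started at the first move that
satisfies `G`, along which the radii decrease by a factor between `β * δ` and `δ`. -/
theorem exists_strategy_subsequence [Nonempty (AliceMove d k β)] (G : BobMove d → Prop)
    (δ : BobMove d → ℝ) (hδ : ∀ c, G c → 0 < δ c ∧ δ c ≤ 1) (hβ : 0 ≤ β) (F : Strategy d k β) :
    ∃ σ : Strategy d k β, ∀ b : ℕ → BobMove d, IsPlay β b →
      Tendsto (fun n => (b n).2) atTop (𝓝 0) → (∃ n, G (b n)) →
      ∃ t : ℕ → ℕ, StrictMono t ∧ G (b (t 0)) ∧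
        ∀ j, (b (t (j + 1))).2 ≤ δ (b (t 0)) * (b (t j)).2 ∧
          β * δ (b (t 0)) * (b (t j)).2 ≤ (b (t (j + 1))).2 ∧
          σ.answer b (t j) = F.answer (b ∘ t) j := by
  classical
  let α : (ℕ → BobMove d) → ℕ → AliceMove d k β := fun b n =>
    -- Before anything is recorded any move will do. Between recorded times the last answer is
    -- repeated, which is harmless.
    match record G δ b n with
    | none => Classical.arbitrary _
    | some (j, c) => F.answer c j
  refine ⟨Strategy.ofRule α, fun b hb hlim hG => ?_⟩
  have hans : ∀ n, (Strategy.ofRule α).answer b n = α b n :=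
    Strategy.answer_ofRule (fun b b' n h => by simp only [α, record_congr h]) b
  set n₀ := Nat.find hG
  have hGn₀ : G (b n₀) := Nat.find_spec hG
  obtain ⟨hδ₀, hδ₁⟩ := hδ _ hGn₀
  have hex : ∀ m, ∃ n, (m < n ∧ (b n).2 ≤ δ (b n₀) * (b m).2) ∧
      ∀ n', m < n' → n' < n → ¬ (b n').2 ≤ δ (b n₀) * (b m).2 := by
    intro m
    have h1 : ∀ᶠ n in atTop, (b n).2 < δ (b n₀) * (b m).2 :=
      hlim.eventually (gt_mem_nhds (mul_pos hδ₀ (hb.radius_pos m)))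
    have h2 : ∃ n, m < n ∧ (b n).2 ≤ δ (b n₀) * (b m).2 :=
      ((eventually_gt_atTop m).and (h1.mono fun _ h => h.le)).exists
    exact ⟨Nat.find h2, Nat.find_spec h2, fun n' h3 h4 h5 => Nat.find_min h2 h4 ⟨h3, h5⟩⟩
  choose next hnext hnext_min using hex
  let t : ℕ → ℕ := fun j => next^[j] n₀
  have ht0 : t 0 = n₀ := rfl
  have hts : ∀ j, t (j + 1) = next (t j) := fun j => Function.iterate_succ_apply' next j n₀
  have htlt : ∀ j, t j < t (j + 1) := fun j => hts j ▸ (hnext (t j)).1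
  have htle : ∀ j, (b (t (j + 1))).2 ≤ δ (b n₀) * (b (t j)).2 := fun j => hts j ▸ (hnext (t j)).2
  have hmin : ∀ j n, t j < n → n < t (j + 1) → ¬ (b n).2 ≤ δ (b n₀) * (b (t j)).2 :=
    fun j n h1 h2 => hnext_min (t j) n h1 (hts j ▸ h2)
  have hmono : StrictMono t := strictMono_nat_of_lt_succ htlt
  have hnone : ∀ n, n < n₀ → record G δ b n = none := by
    intro n
    induction n with
    | zero => intro h; simp [record, Nat.find_min hG h]
    | succ n ih => intro h; simp [record, ih (by omega), Nat.find_min hG h]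
  have hstart : record G δ b n₀ = some (0, fun _ => b n₀) := by
    rcases h : n₀ with _ | n
    · rw [h] at hGn₀; simp [record, hGn₀]
    · rw [h] at hGn₀
      simp [record, hnone n (by omega), hGn₀]
  have hrec : ∀ j n, t j ≤ n → n < t (j + 1) →
      ∃ c, record G δ b n = some (j, c) ∧ ∀ i ≤ j, c i = b (t i) := by
    have hfrom : ∀ j, (∃ c, record G δ b (t j) = some (j, c) ∧ ∀ i ≤ j, c i = b (t i)) →
        ∀ n, t j ≤ n → n < t (j + 1) →
          ∃ c, record G δ b n = some (j, c) ∧ ∀ i ≤ j, c i = b (t i) := by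
      rintro j ⟨c, hc, hci⟩ n hn
      induction n, hn using Nat.le_induction with
      | base => exact fun _ => ⟨c, hc, hci⟩
      | succ n hn ih =>
        intro h
        obtain ⟨c', hc', hci'⟩ := ih (by omega)
        refine ⟨c', ?_, hci'⟩
        rw [record, hc']
        simp only
        rw [hci' 0 (Nat.zero_le _), hci' j le_rfl, ht0, if_neg (hmin j (n + 1) (by omega) h)]
    intro j
    induction j with
    | zero =>
      refine hfrom 0 ⟨_, hstart, fun i hi => ?_⟩
      rw [Nat.le_zero.1 hi, ht0]
    | succ j ih =>
      refine hfrom (j + 1) ?_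
      obtain ⟨m, hm⟩ : ∃ m, t (j + 1) = m + 1 := ⟨t (j + 1) - 1, by have := htlt j; omega⟩
      have h3 := htlt j
      obtain ⟨c, hc, hci⟩ := ih m (by omega) (by omega)
      refine ⟨Function.update c (j + 1) (b (t (j + 1))), ?_, fun i hi => ?_⟩
      · have h4 := htle j
        rw [hm] at h4 ⊢
        rw [record, hc]
        simp only
        rw [hci 0 (Nat.zero_le _), hci j le_rfl, ht0, if_pos h4]
      · rcases Nat.le_succ_iff.1 hi with h | rfl
        · rw [Function.update_of_ne (by omega), hci i h]
        · simp
  refine ⟨t, hmono, hGn₀, fun j => ⟨htle j, ?_, ?_⟩⟩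
  · obtain ⟨m, hm⟩ : ∃ m, t (j + 1) = m + 1 := ⟨t (j + 1) - 1, by have := htlt j; omega⟩
    have h1 := hb.mul_le_radius_succ m
    rw [hm]
    refine le_trans ?_ h1
    rw [mul_assoc]
    refine mul_le_mul_of_nonneg_left ?_ hβ
    have h3 := htlt j
    -- The ball just before the next recorded one still has radius at least `δ` times the last
    -- recorded radius: either it is that recorded ball, and `δ ≤ 1`, or it was rejected. One
    -- further move costs a factor `β`.
    rcases (show t j = m ∨ t j < m by omega) with h2 | h2
    · rw [h2]
      exact mul_le_of_le_one_left (hb.radius_pos m).le hδ₁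
    · exact (not_le.1 (hmin j m h2 (by omega))).le
  · obtain ⟨c, hc, hci⟩ := hrec j (t j) le_rfl (htlt j)
    rw [hans]
    simp only [α, hc]
    exact F.answer_congr hci

/-! ### Countable intersections -/

/-- If for every parameter Alice can win for each of countably many targets, then she can win for
their intersection, playing for the `i`-th target at the times `2 ^ i * (2 * j + 1) - 1`. -/
theorem exists_winsSmall_iInter {T : ℕ → Set (EuclideanSpace ℝ (Fin d))} {r : ℝ}
    (h : ∀ i, ∀ β : ℝ, 0 < β → β < 1 → ∃ σ : Strategy d k β, σ.WinsSmall r (T i))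
    (hβ : 0 < β) (hβ1 : β < 1) : ∃ σ : Strategy d k β, σ.WinsSmall r (⋂ i, T i) := by
  have hpow : ∀ i : ℕ, β ^ 2 ^ (i + 1) ≤ β := fun i =>
    pow_le_of_le_one hβ.le hβ1.le (by positivity)
  -- Consecutive times for the `i`-th target are `2 ^ (i + 1)` moves apart, so the subsampled play
  -- shrinks by at worst this power of `β`.
  choose σ hσ using fun i : ℕ => h i (β ^ 2 ^ (i + 1)) (by positivity) ((hpow i).trans_lt hβ1)
  let τ : ℕ → ℕ → ℕ := fun i j => 2 ^ i * (2 * j + 1) - 1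
  have hτ1 : ∀ i j, τ i j + 1 = 2 ^ i * (2 * j + 1) := fun i j =>
    Nat.sub_add_cancel (Nat.mul_pos (by positivity) (by omega))
  have hτs : ∀ i j, τ i (j + 1) = τ i j + 2 ^ (i + 1) := by
    intro i j
    have h1 := hτ1 i j
    have h2 := hτ1 i (j + 1)
    have h3 : 2 ^ i * (2 * (j + 1) + 1) = 2 ^ i * (2 * j + 1) + 2 ^ (i + 1) := by ring
    omega
  have hτmono : ∀ i, Monotone (τ i) := fun i =>
    monotone_nat_of_le_succ fun j => hτs i j ▸ Nat.le_add_right _ _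
  let I : ℕ → ℕ := fun n => padicValNat 2 (n + 1)
  let J : ℕ → ℕ := fun n => (n + 1) / 2 ^ (I n + 1)
  have hI : ∀ i j, I (τ i j) = i := by
    intro i j
    simp only [I, hτ1]
    rw [padicValNat.mul (by positivity) (by omega), padicValNat.prime_pow,
      padicValNat.eq_zero_of_not_dvd (by omega), add_zero]
  have hJ : ∀ i j, J (τ i j) = j := by
    intro i j
    simp only [J, hI, hτ1]
    rw [pow_succ, ← Nat.div_div_eq_div_mul, Nat.mul_div_cancel_left _ (by positivity)]
    omega
  -- In fact `n + 1 = 2 ^ I n * (2 * J n + 1)`, so equality holds; the inequality is enough for the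
  -- rule not to look ahead.
  have hτJ : ∀ n, τ (I n) (J n) ≤ n := by
    intro n
    have h1 := hτ1 (I n) (J n)
    have h2 : 2 ^ I n ∣ n + 1 := pow_padicValNat_dvd
    obtain ⟨q, hq⟩ := h2
    have hJq : J n = q / 2 := by
      simp only [J]
      rw [pow_succ, ← Nat.div_div_eq_div_mul]
      conv_lhs => rw [hq, Nat.mul_div_cancel_left _ (by positivity)]
    have h3 : ¬ 2 ∣ q := by
      rintro ⟨s, rfl⟩
      refine pow_succ_padicValNat_not_dvd (p := 2) (n := n + 1) (by omega) ⟨s, ?_⟩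
      rw [pow_succ, mul_assoc]
      exact hq
    have h4 : 2 * J n + 1 = q := by omega
    rw [h4, ← hq] at h1
    omega
  let relax : ∀ i, AliceMove d k (β ^ 2 ^ (i + 1)) → AliceMove d k β := fun i a =>
    { plane := a.plane
      plane_nonempty := a.plane_nonempty
      finrank_direction := a.finrank_direction
      width := a.width
      width_pos := a.width_pos
      width_le := a.width_le.trans (hpow i) }
  let α : (ℕ → BobMove d) → ℕ → AliceMove d k β := fun b n =>
    relax (I n) ((σ (I n)).answer (b ∘ τ (I n)) (J n))
  have hα : ∀ b n, (Strategy.ofRule α).answer b n = α b n := by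
    refine Strategy.answer_ofRule fun b b' n hbb => ?_
    simp only [α]
    congr 1
    exact Strategy.answer_congr _ fun j hj => hbb _ ((hτmono _ hj).trans (hτJ n))
  refine ⟨Strategy.ofRule α, fun b hb hlim hleg x hx => Set.mem_iInter.2 fun i => ?_⟩
  have htend : Tendsto (τ i) atTop atTop :=
    (strictMono_nat_of_lt_succ fun j => by
      rw [hτs]; have : 0 < 2 ^ (i + 1) := by positivity
      omega).tendsto_atTop
  refine hσ i (b ∘ τ i) ⟨fun n => hb.radius_pos _, fun n => ?_, fun n => ?_⟩ (hlim.comp htend)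
    (fun n hn => ?_) x fun n => hx _
  · simp only [Function.comp, hτs]
    exact hb.pow_mul_le_radius hβ.le _ _
  · exact hb.dist_add_radius_le_of_le (hτmono i n.le_succ)
  · have h1 := hleg (τ i n) hn
    rw [hα] at h1
    have h2 : τ i n + 1 ≤ τ i (n + 1) := by
      rw [hτs]; have : 0 < 2 ^ (i + 1) := by positivity
      omega
    refine Disjoint.mono_left (hb.ball_subset h2) ?_
    have h3 : (α b (τ i n)).removed (b (τ i n)) =
        ((σ i).answer (b ∘ τ i) n).removed ((b ∘ τ i) n) := by
      simp only [α, relax, AliceMove.removed, Function.comp_apply]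
      rw [hI, hJ]
    rwa [h3] at h1

/-! ### Planes and balls -/

theorem notMem_thickening_iff {X : Type*} [PseudoMetricSpace X] {ε : ℝ} {s : Set X} {x : X} :
    x ∉ Metric.thickening ε s ↔ ∀ p ∈ s, ε ≤ dist x p := by
  simp [Metric.mem_thickening_iff]

theorem exists_submodule_finrank_eq (hk : k ≤ d) :
    ∃ W : Submodule ℝ (EuclideanSpace ℝ (Fin d)), Module.finrank ℝ W = k := by
  obtain ⟨v, hv⟩ := exists_linearIndependent_of_le_finrank (R := ℝ)
    (M := EuclideanSpace ℝ (Fin d)) (n := k) (by simpa using hk)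
  exact ⟨Submodule.span ℝ (Set.range v), by simpa using finrank_span_eq_card hv⟩

theorem exists_unit_orthogonal {W : Submodule ℝ (EuclideanSpace ℝ (Fin d))}
    (hW : Module.finrank ℝ W < d) :
    ∃ v : EuclideanSpace ℝ (Fin d), ‖v‖ = 1 ∧ ∀ w ∈ W, inner ℝ w v = 0 := by
  have hne : Wᗮ ≠ ⊥ := by
    intro h
    rw [Submodule.orthogonal_eq_bot_iff] at h
    rw [h, finrank_top, finrank_euclideanSpace_fin] at hW
    exact lt_irrefl _ hW
  obtain ⟨u, hu, hu0⟩ := Submodule.exists_mem_ne_zero_of_ne_bot hne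
  refine ⟨(‖u‖)⁻¹ • u, by simp [norm_smul, hu0], fun w hw => ?_⟩
  rw [inner_smul_right, (Submodule.mem_orthogonal W u).1 hu w hw, mul_zero]

/-- Through every point there is a plane of dimension `k`. -/
theorem exists_plane (hk : k ≤ d) (x : EuclideanSpace ℝ (Fin d)) :
    ∃ L : AffineSubspace ℝ (EuclideanSpace ℝ (Fin d)), x ∈ L ∧
      Module.finrank ℝ L.direction = k := by
  obtain ⟨W, hW⟩ := exists_submodule_finrank_eq hk
  exact ⟨AffineSubspace.mk' x W, AffineSubspace.self_mem_mk' x W, by rw [AffineSubspace.direction_mk', hW]⟩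

theorem abs_inner_sub_le_dist {v : EuclideanSpace ℝ (Fin d)} (hv : ‖v‖ = 1)
    (x y : EuclideanSpace ℝ (Fin d)) : |inner ℝ (x - y) v| ≤ dist x y := by
  simpa [hv, dist_eq_norm] using abs_real_inner_le_norm (x - y) v

/-- In every ball there is a point whose distance from a given proper plane is at least the
radius. -/
theorem exists_mem_closedBall_le_dist (hk : k < d)
    {L : AffineSubspace ℝ (EuclideanSpace ℝ (Fin d))}
    (hne : (L : Set (EuclideanSpace ℝ (Fin d))).Nonempty)
    (hL : Module.finrank ℝ L.direction = k) (x : EuclideanSpace ℝ (Fin d)) {ρ : ℝ} (hρ : 0 ≤ ρ) :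
    ∃ y ∈ Metric.closedBall x ρ, ∀ p ∈ L, ρ ≤ dist y p := by
  obtain ⟨v, hv, hvL⟩ := exists_unit_orthogonal (hL.trans_lt hk)
  obtain ⟨p₀, hp₀⟩ := hne
  have hvv : inner ℝ v v = (1 : ℝ) := by simp [hv]
  have key : ∀ p ∈ L, inner ℝ (x - p) v = inner ℝ (x - p₀) v := by
    intro p hp
    have := hvL (p₀ - p) (AffineSubspace.vsub_mem_direction hp₀ hp)
    rw [show x - p = (x - p₀) + (p₀ - p) by abel, inner_add_left, this, add_zero]
  rcases le_total 0 (inner ℝ (x - p₀) v) with h | h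
  · refine ⟨x + ρ • v, by simp [norm_smul, hv, abs_of_nonneg hρ], fun p hp => ?_⟩
    refine le_trans (le_trans ?_ (le_abs_self _)) (abs_inner_sub_le_dist hv _ _)
    rw [show x + ρ • v - p = (x - p) + ρ • v by abel, inner_add_left, key p hp, inner_smul_left,
      hvv]
    simpa using h
  · refine ⟨x - ρ • v, by simp [norm_smul, hv, abs_of_nonneg hρ], fun p hp => ?_⟩
    refine le_trans (le_trans ?_ (neg_le_abs _)) (abs_inner_sub_le_dist hv _ _)
    rw [show x - ρ • v - p = (x - p) - ρ • v by abel, inner_sub_left, key p hp, inner_smul_left,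
      hvv]
    simpa using h

theorem isBetaDiffuse_univ (hk : k < d) :
    IsBetaDiffuse k (1 / 2) (Set.univ : Set (EuclideanSpace ℝ (Fin d))) := by
  refine ⟨isClosed_univ, 1, one_pos, fun ρ hρ _ x _ L hne hL => ?_⟩
  obtain ⟨y, hy, hyL⟩ := exists_mem_closedBall_le_dist hk hne hL x hρ.le
  exact ⟨y, Set.mem_univ _, hy, notMem_thickening_iff.2 fun p hp => by linarith [hyL p hp]⟩

theorem nonempty_aliceMove (hk : k ≤ d) (hβ : 0 < β) : Nonempty (AliceMove d k β) := by
  obtain ⟨L, hx, hL⟩ := exists_plane hk 0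
  exact ⟨⟨L, ⟨0, hx⟩, hL, β, hβ, le_rfl⟩⟩

/-- Alice can make a move that does not restrict Bob. -/
theorem exists_aliceMove_disjoint (hk : k < d) (hβ : 0 < β) (hβ1 : β < 1) (b : BobMove d)
    (hb : 0 < b.2) : ∃ a : AliceMove d k β, Disjoint b.ball (a.removed b) := by
  obtain ⟨W, hW⟩ := exists_submodule_finrank_eq hk.le
  obtain ⟨v, hv, hvW⟩ := exists_unit_orthogonal (hW.trans_lt hk)
  have hvv : inner ℝ v v = (1 : ℝ) := by simp [hv]
  -- A plane at distance twice the radius from the centre stays at least one radius away from the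
  -- ball, and `β < 1`.
  refine ⟨⟨AffineSubspace.mk' (b.1 + (2 * b.2) • v) W, AffineSubspace.mk'_nonempty _ _,
    by rw [AffineSubspace.direction_mk', hW], β, hβ, le_rfl⟩, Set.disjoint_left.2 fun y hy => ?_⟩
  simp only [AliceMove.removed]
  refine notMem_thickening_iff.2 fun p hp => ?_
  have h1 : |inner ℝ (y - b.1) v| ≤ b.2 := (abs_inner_sub_le_dist hv _ _).trans hy
  have h2 := abs_inner_sub_le_dist hv p y
  have h3 : inner ℝ (p - (b.1 + (2 * b.2) • v)) v = 0 := hvW _ (AffineSubspace.mem_mk'.1 hp)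
  rw [dist_comm]
  refine le_trans ?_ ((le_abs_self _).trans h2)
  rw [show p - y = (p - (b.1 + (2 * b.2) • v)) + ((2 * b.2) • v - (y - b.1)) by abel,
    inner_add_left, h3, inner_sub_left, inner_smul_left, hvv]
  have := (abs_le.1 h1).2
  simp only [conj_trivial, mul_one, zero_add]
  nlinarith

/-- Test the inclusion on the point of the smaller ball farthest from `x`, in the direction of `y -
x`. In dimension zero all balls coincide and no such bound holds. -/
theorem dist_add_le_of_closedBall_subset (hd : 0 < d) {x y : EuclideanSpace ℝ (Fin d)}
    {ρ ρ' : ℝ} (hρ' : 0 ≤ ρ') (h : Metric.closedBall y ρ' ⊆ Metric.closedBall x ρ) :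
    dist y x + ρ' ≤ ρ := by
  obtain ⟨v, hv, hvy⟩ : ∃ v : EuclideanSpace ℝ (Fin d), ‖v‖ = 1 ∧ y - x = dist y x • v := by
    rcases eq_or_ne y x with rfl | hne
    · obtain ⟨v, hv, -⟩ := exists_unit_orthogonal
        (W := (⊥ : Submodule ℝ (EuclideanSpace ℝ (Fin d)))) (by simpa using hd)
      exact ⟨v, hv, by simp⟩
    · have h0 : ‖y - x‖ ≠ 0 := norm_ne_zero_iff.2 (sub_ne_zero.2 hne)
      refine ⟨‖y - x‖⁻¹ • (y - x), by rw [norm_smul, norm_inv, norm_norm, inv_mul_cancel₀ h0], ?_⟩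
      rw [dist_eq_norm, smul_smul, mul_inv_cancel₀ h0, one_smul]
  have h1 : y + ρ' • v ∈ Metric.closedBall y ρ' := by simp [norm_smul, hv, abs_of_nonneg hρ']
  have h2 := h h1
  rw [Metric.mem_closedBall, dist_eq_norm,
    show y + ρ' • v - x = (y - x) + ρ' • v by abel, hvy, ← add_smul, norm_smul, hv, mul_one,
    Real.norm_of_nonneg (by positivity)] at h2
  exact h2

/-! ### Diffuse sets -/

/-- Near every point of a diffuse set and away from a given plane there are two points of the set
that are far from each other. -/
theorem exists_separated_points (hk : k < d) {K : Set (EuclideanSpace ℝ (Fin d))} {γ ρK : ℝ}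
    (hγ : 0 < γ) (hγ1 : γ < 1)
    (hK : ∀ ρ : ℝ, 0 < ρ → ρ ≤ ρK → ∀ x ∈ K, ∀ L : AffineSubspace ℝ (EuclideanSpace ℝ (Fin d)),
      (L : Set (EuclideanSpace ℝ (Fin d))).Nonempty → Module.finrank ℝ L.direction = k →
        ∃ x' ∈ K, x' ∈ Metric.closedBall x ρ \
          Metric.thickening (γ * ρ) (L : Set (EuclideanSpace ℝ (Fin d))))
    {ρ : ℝ} (hρ : 0 < ρ) (hρK : ρ ≤ ρK) {x : EuclideanSpace ℝ (Fin d)} (hx : x ∈ K)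
    {L : AffineSubspace ℝ (EuclideanSpace ℝ (Fin d))}
    (hne : (L : Set (EuclideanSpace ℝ (Fin d))).Nonempty)
    (hL : Module.finrank ℝ L.direction = k) :
    ∃ y : Fin 2 → EuclideanSpace ℝ (Fin d),
      (∀ i, y i ∈ K ∧ dist (y i) x ≤ 3 / 4 * ρ ∧ ∀ p ∈ L, γ / 4 * ρ ≤ dist (y i) p) ∧
      ∀ i j, i ≠ j → γ ^ 2 / 4 * ρ ≤ dist (y i) (y j) := by
  -- The point `y₀` is at least `γ * ρ / 2` from `L`. The second point is found within half that
  -- distance of `y₀`, so it stays `γ / 4 * ρ` from `L`; avoiding a plane through `y₀` forces it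
  -- away from `y₀`.
  obtain ⟨y₀, h0K, h0, h0L⟩ := hK (ρ / 2) (by linarith) (by linarith) x hx L hne hL
  obtain ⟨L', h0L', hL'⟩ := exists_plane hk.le y₀
  have hγρ : 0 < γ * ρ := mul_pos hγ hρ
  have hγρ' : γ * ρ < ρ := by nlinarith
  obtain ⟨y₁, h1K, h1, h1L⟩ := hK (γ / 4 * ρ) (by positivity) (by linarith) y₀ h0K L' ⟨y₀, h0L'⟩ hL'
  rw [notMem_thickening_iff] at h0L h1L
  rw [Metric.mem_closedBall] at h0 h1
  have h10 := h1L y₀ h0L'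
  have h10' : γ ^ 2 / 4 * ρ ≤ dist y₁ y₀ := by
    refine le_trans (le_of_eq ?_) h10
    ring
  refine ⟨![y₀, y₁], fun i => ?_, fun i j hij => ?_⟩
  · fin_cases i
    · refine ⟨h0K, ?_, fun p hp => ?_⟩
      · simp only [Fin.zero_eta, Matrix.cons_val_zero]; linarith
      · have := h0L p hp
        simp only [Fin.zero_eta, Matrix.cons_val_zero]; linarith
    · refine ⟨h1K, ?_, fun p hp => ?_⟩
      · have := dist_triangle y₁ y₀ x
        simp only [Fin.mk_one, Matrix.cons_val_one, Matrix.cons_val_fin_one]; linarith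
      · have := h0L p hp
        have := dist_triangle y₀ y₁ p
        rw [dist_comm y₀ y₁] at this
        simp only [Fin.mk_one, Matrix.cons_val_one, Matrix.cons_val_fin_one]; linarith
  · fin_cases i <;> fin_cases j <;> simp_all [dist_comm]

/-- On a diffuse set, Bob always has two legal answers that are far from each other, provided
`β` and his current ball are small. -/
theorem exists_separated_legalNext (hk : k < d) {K : Set (EuclideanSpace ℝ (Fin d))} {γ : ℝ}
    (hγ : 0 < γ) (hγ1 : γ < 1) (hK : IsBetaDiffuse k γ K) :
    ∃ ρK : ℝ, 0 < ρK ∧ ∀ β : ℝ, 0 < β → β ≤ γ ^ 2 / 12 → ∀ b : BobMove d, b.1 ∈ K → 0 < b.2 →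
      b.2 ≤ ρK → ∀ a : AliceMove d k β,
        ∃ y : Fin 2 → EuclideanSpace ℝ (Fin d), (∀ i, LegalNext K b a (y i, β * b.2)) ∧
          ∀ i j, i ≠ j → 3 * β * b.2 ≤ dist (y i) (y j) := by
  obtain ⟨-, ρK, hρK, hdiff⟩ := hK
  refine ⟨ρK, hρK, fun β hβ hβγ b hbK hb hbρ a => ?_⟩
  obtain ⟨y, hy, hsep⟩ := exists_separated_points hk hγ hγ1 hdiff hb hbρ hbK a.plane_nonempty
    a.finrank_direction
  have hβ12 : β ≤ γ / 12 := by nlinarith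
  refine ⟨y, fun i => ⟨(hy i).1, mul_pos hβ hb, le_rfl, fun z hz => ?_⟩, fun i j hij => ?_⟩
  · have hz : dist z (y i) ≤ β * b.2 := hz
    refine ⟨?_, ?_⟩
    · have h1 := (hy i).2.1
      have h2 := dist_triangle z (y i) b.1
      have : dist z b.1 ≤ b.2 := by nlinarith
      exact this
    · refine notMem_thickening_iff.2 fun p hp => ?_
      have h1 := (hy i).2.2 p hp
      have h2 := dist_triangle (y i) z p
      rw [dist_comm (y i) z] at h2
      have h3 : a.width * b.2 ≤ β * b.2 := mul_le_mul_of_nonneg_right a.width_le hb.le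
      have h4 : β * b.2 ≤ γ / 12 * b.2 := mul_le_mul_of_nonneg_right hβ12 hb.le
      nlinarith
  · refine le_trans ?_ (hsep i j hij)
    nlinarith

/-! ### Preimages under nonsingular `C¹` maps -/

/-- On the set `s` the map `f` is close to the invertible linear map `A`, which expands norms at
least by the factor `m`, and is Lipschitz with constant `C`. -/
structure IsNearlyLinearOn (β : ℝ) (f : EuclideanSpace ℝ (Fin d) → EuclideanSpace ℝ (Fin d))
    (s : Set (EuclideanSpace ℝ (Fin d)))
    (A : EuclideanSpace ℝ (Fin d) ≃L[ℝ] EuclideanSpace ℝ (Fin d)) (m C : ℝ) : Prop where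
  pos : 0 < m
  le : m ≤ C
  mul_norm_le : ∀ v, m * ‖v‖ ≤ ‖A v‖
  norm_sub_le : ∀ y ∈ s, ∀ z ∈ s, ‖f y - f z - A (y - z)‖ ≤ β * m / 2 * ‖y - z‖
  dist_le : ∀ y ∈ s, ∀ z ∈ s, dist (f y) (f z) ≤ C * dist y z

theorem IsNearlyLinearOn.mono {f : EuclideanSpace ℝ (Fin d) → EuclideanSpace ℝ (Fin d)}
    {s t : Set (EuclideanSpace ℝ (Fin d))}
    {A : EuclideanSpace ℝ (Fin d) ≃L[ℝ] EuclideanSpace ℝ (Fin d)} {m C : ℝ}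
    (h : IsNearlyLinearOn β f t A m C) (hst : s ⊆ t) : IsNearlyLinearOn β f s A m C :=
  ⟨h.pos, h.le, h.mul_norm_le, fun y hy z hz => h.norm_sub_le y (hst hy) z (hst hz),
    fun y hy z hz => h.dist_le y (hst hy) z (hst hz)⟩

/-- A `C¹` map is strictly differentiable, so its error against `A` is Lipschitz with arbitrarily
small constant near `x`. The expansion bound comes from the norm of the inverse; adding 1 there
keeps `m` well defined even if that norm vanishes. -/
theorem exists_isNearlyLinearOn {f : EuclideanSpace ℝ (Fin d) → EuclideanSpace ℝ (Fin d)}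
    {U : Set (EuclideanSpace ℝ (Fin d))} (hU : IsOpen U) (hf : IsNonsingularC1On f U)
    (hβ : 0 < β) (hβ1 : β < 1) {x : EuclideanSpace ℝ (Fin d)} (hx : x ∈ U) :
    ∃ s ∈ 𝓝 x, ∃ A m C, IsNearlyLinearOn β f s A m C := by
  obtain ⟨A, hA⟩ := hf.2 x hx
  have hstrict : HasStrictFDerivAt f (A : EuclideanSpace ℝ (Fin d) →L[ℝ] _) x := by
    rw [hA]
    exact (hf.1.contDiffAt (hU.mem_nhds hx)).hasStrictFDerivAt one_ne_zero
  set m : ℝ := (‖(A.symm : EuclideanSpace ℝ (Fin d) →L[ℝ] EuclideanSpace ℝ (Fin d))‖ + 1)⁻¹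
    with hm
  have hm0 : 0 < m := by positivity
  have hc : 0 < β * m / 2 := by positivity
  obtain ⟨s, hs, happ⟩ := hstrict.approximates_deriv_on_nhds (c := ⟨β * m / 2, hc.le⟩)
    (Or.inr (by exact_mod_cast hc))
  have happ' : ∀ y ∈ s, ∀ z ∈ s, ‖f y - f z - A (y - z)‖ ≤ β * m / 2 * ‖y - z‖ :=
    fun y hy z hz => happ y hy z hz
  refine ⟨s, hs, A, m, ‖(A : EuclideanSpace ℝ (Fin d) →L[ℝ] EuclideanSpace ℝ (Fin d))‖ + m,
    hm0, by linarith [norm_nonneg (A : EuclideanSpace ℝ (Fin d) →L[ℝ] EuclideanSpace ℝ (Fin d))],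
    fun v => ?_, happ', fun y hy z hz => ?_⟩
  · rw [hm, inv_mul_le_iff₀ (by positivity)]
    have h1 := (A.symm : EuclideanSpace ℝ (Fin d) →L[ℝ] EuclideanSpace ℝ (Fin d)).le_opNorm (A v)
    simp only [ContinuousLinearEquiv.coe_coe, ContinuousLinearEquiv.symm_apply_apply] at h1
    linarith [norm_nonneg (A v)]
  · rw [dist_eq_norm, dist_eq_norm]
    have h1 := happ' y hy z hz
    have h2 := (A : EuclideanSpace ℝ (Fin d) →L[ℝ] EuclideanSpace ℝ (Fin d)).le_opNorm (y - z)
    simp only [ContinuousLinearEquiv.coe_coe] at h2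
    have h3 : ‖f y - f z‖ ≤ ‖f y - f z - A (y - z)‖ + ‖A (y - z)‖ := by
      simpa using norm_add_le (f y - f z - A (y - z)) (A (y - z))
    have h4 : β * m / 2 * ‖y - z‖ ≤ m * ‖y - z‖ :=
      mul_le_mul_of_nonneg_right (by nlinarith) (norm_nonneg _)
    linarith

/-- The preimage of a plane under an affine isomorphism. -/
theorem exists_plane_preimage (A : EuclideanSpace ℝ (Fin d) ≃L[ℝ] EuclideanSpace ℝ (Fin d))
    (x w : EuclideanSpace ℝ (Fin d)) {L : AffineSubspace ℝ (EuclideanSpace ℝ (Fin d))}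
    (hne : (L : Set (EuclideanSpace ℝ (Fin d))).Nonempty)
    (hL : Module.finrank ℝ L.direction = k) :
    ∃ L' : AffineSubspace ℝ (EuclideanSpace ℝ (Fin d)),
      (L' : Set (EuclideanSpace ℝ (Fin d))).Nonempty ∧ Module.finrank ℝ L'.direction = k ∧
        ∀ p ∈ L, x + A.symm (p - w) ∈ L' := by
  obtain ⟨p₀, hp₀⟩ := hne
  refine ⟨AffineSubspace.mk' (x + A.symm (p₀ - w))
    (L.direction.map (A.symm.toLinearEquiv : EuclideanSpace ℝ (Fin d) →ₗ[ℝ] _)),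
    AffineSubspace.mk'_nonempty _ _, ?_, fun p hp => ?_⟩
  · rw [AffineSubspace.direction_mk', LinearEquiv.finrank_map_eq, hL]
  · rw [AffineSubspace.mem_mk']
    refine ⟨p - p₀, AffineSubspace.vsub_mem_direction hp hp₀, ?_⟩
    simp

/-- If Bob's answer `b'` avoids the preimage of Alice's plane and is small enough, then its image
is a legal answer in the image game. -/
theorem IsNearlyLinearOn.legalNext {f : EuclideanSpace ℝ (Fin d) → EuclideanSpace ℝ (Fin d)}
    {b b' : BobMove d} {A : EuclideanSpace ℝ (Fin d) ≃L[ℝ] EuclideanSpace ℝ (Fin d)} {m C : ℝ}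
    {s : Set (EuclideanSpace ℝ (Fin d))} (h : IsNearlyLinearOn β f s A m C)
    (hs : b.1 ∈ s) (hs' : b'.1 ∈ s)
    (hβ : 0 < β) (hβ1 : β < 1) (hb : 0 < b.2) (hb' : 0 < b'.2)
    (hnest : dist b'.1 b.1 + b'.2 ≤ b.2) (hsmall : b'.2 ≤ β * m / (4 * C) * b.2)
    (hlarge : β * (β * m / (4 * C)) * b.2 ≤ b'.2)
    (a : AliceMove d k (β * (β * m / (4 * C))))
    {L : AffineSubspace ℝ (EuclideanSpace ℝ (Fin d))}
    (hL : ∀ p ∈ a.plane, b.1 + A.symm (p - f b.1) ∈ L) (havoid : ∀ p ∈ L, β * b.2 ≤ dist b'.1 p) :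
    LegalNext Set.univ (f b.1, C * b.2) a (f b'.1, C * b'.2) := by
  have hC : 0 < C := h.pos.trans_le h.le
  have hbb : dist b'.1 b.1 ≤ b.2 := by linarith
  have hdist := h.dist_le _ hs' _ hs
  have hδC : C * (β * m / (4 * C)) = β * m / 4 := by field_simp
  -- Expansion by `m` gives `β * m * b.2`, and the linearization error costs half. The remaining
  -- half is split equally between the radius of the image ball and the width of the removed
  -- neighbourhood.
  have hfar : ∀ p ∈ a.plane, β * m / 2 * b.2 ≤ dist (f b'.1) p := by
    intro p hp
    have h1 := havoid _ (hL p hp)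
    have h2 := h.norm_sub_le _ hs' _ hs
    have h3 := h.mul_norm_le (b'.1 - (b.1 + A.symm (p - f b.1)))
    have h4 : A (b'.1 - (b.1 + A.symm (p - f b.1))) =
        (f b'.1 - p) - (f b'.1 - f b.1 - A (b'.1 - b.1)) := by
      simp only [map_sub, map_add, ContinuousLinearEquiv.apply_symm_apply]
      abel
    rw [h4] at h3
    have h5 := _root_.norm_sub_le (f b'.1 - p) (f b'.1 - f b.1 - A (b'.1 - b.1))
    rw [dist_eq_norm] at h1 hbb ⊢
    have h6 := mul_le_mul_of_nonneg_left h1 h.pos.le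
    have h7 : β * m / 2 * ‖b'.1 - b.1‖ ≤ β * m / 2 * b.2 :=
      mul_le_mul_of_nonneg_left hbb (by have := h.pos; positivity)
    linarith
  refine ⟨Set.mem_univ _, mul_pos hC hb', ?_, ?_⟩
  · calc β * (β * m / (4 * C)) * (C * b.2) = C * (β * (β * m / (4 * C)) * b.2) := by ring
      _ ≤ C * b'.2 := by gcongr
  · intro q hq
    have hq : dist q (f b'.1) ≤ C * b'.2 := hq
    refine ⟨?_, notMem_thickening_iff.2 fun p hp => ?_⟩
    · have h1 := dist_triangle q (f b'.1) (f b.1)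
      have : dist q (f b.1) ≤ C * b.2 := by nlinarith
      exact this
    · have h1 := hfar p hp
      have h2 := dist_triangle (f b'.1) q p
      rw [dist_comm (f b'.1) q] at h2
      have h3 : C * b'.2 ≤ β * m / 4 * b.2 := by
        rw [← hδC, mul_assoc]; gcongr
      have h4 : a.width * (C * b.2) ≤ β * m / 4 * b.2 := by
        have h5 : a.width ≤ β * m / (4 * C) := by
          refine a.width_le.trans (mul_le_of_le_one_left ?_ hβ1.le)
          have := h.pos
          positivity
        calc a.width * (C * b.2) ≤ β * m / (4 * C) * (C * b.2) := by gcongr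
          _ = β * m / 4 * b.2 := by rw [← hδC]; ring
      simp only
      linarith

/-- Preimages of absolute winning sets under nonsingular `C¹` maps can be won against shrinking
plays, for all parameters. -/
theorem exists_winsSmall_preimage (hk : k < d) {S U : Set (EuclideanSpace ℝ (Fin d))}
    (hS : IsAbsoluteWinning k S) (hU : IsOpen U)
    {f : EuclideanSpace ℝ (Fin d) → EuclideanSpace ℝ (Fin d)} (hf : IsNonsingularC1On f U)
    {r : ℝ} (hr : 0 < r) (hβ : 0 < β) (hβ1 : β < 1) :
    ∃ σ : Strategy d k β, σ.WinsSmall r ((U ∩ f ⁻¹' S) ∪ Uᶜ) := by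
  classical
  have := nonempty_aliceMove hk.le hβ
  let G : BobMove d → Prop := fun c =>
    c.2 ≤ r ∧ c.ball ⊆ U ∧ ∃ A m C, IsNearlyLinearOn β f c.ball A m C
  choose A m C hlin using fun (c : BobMove d) (hc : G c) => hc.2.2
  -- The bound `1 / 4` keeps the parameter of the simulated game below `1 / 3`, where `S` is known
  -- to be winning.
  have hδ : ∀ c hc, 0 < β * m c hc / (4 * C c hc) ∧ β * m c hc / (4 * C c hc) ≤ 1 / 4 := by
    intro c hc
    have h1 := (hlin c hc).pos
    have h2 := (hlin c hc).le
    have h3 : 0 < C c hc := h1.trans_le h2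
    refine ⟨by positivity, ?_⟩
    rw [div_le_iff₀ (by positivity)]
    nlinarith
  choose σ' hσ' using fun c hc => hS (β * (β * m c hc / (4 * C c hc)))
    (mul_pos hβ (hδ c hc).1) (by nlinarith [(hδ c hc).1, (hδ c hc).2])
  choose P hPne hPdim hP using fun (A : EuclideanSpace ℝ (Fin d) ≃L[ℝ] EuclideanSpace ℝ (Fin d))
    (x w : EuclideanSpace ℝ (Fin d)) (β' : ℝ) (a : AliceMove d k β') =>
      exists_plane_preimage A x w a.plane_nonempty a.finrank_direction
  let pull : (β' : ℝ) → AliceMove d k β' →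
      (EuclideanSpace ℝ (Fin d) ≃L[ℝ] EuclideanSpace ℝ (Fin d)) → EuclideanSpace ℝ (Fin d) →
      AliceMove d k β := fun β' a A x =>
    ⟨P A x (f x) β' a, hPne _ _ _ _ _, hPdim _ _ _ _ _, β, hβ, le_rfl⟩
  let F : Strategy d k β := fun n h =>
    if hc : G (h 0) then
      pull _ (σ' (h 0) hc n fun i => (f (h i).1, C (h 0) hc * (h i).2)) (A (h 0) hc)
        (h (Fin.last n)).1
    else Classical.arbitrary _
  let δ : BobMove d → ℝ := fun c => if hc : G c then β * m c hc / (4 * C c hc) else 1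
  obtain ⟨σ, hσ⟩ := exists_strategy_subsequence G δ (fun c hc => by
    simp only [δ, dif_pos hc]
    exact ⟨(hδ c hc).1, (hδ c hc).2.trans (by norm_num)⟩) hβ.le F
  refine ⟨σ, fun b hb hlim hleg x hx => ?_⟩
  by_cases hxU : x ∈ U
  swap
  · exact Or.inr hxU
  have hG : ∃ n, G (b n) := by
    obtain ⟨s, hs, A, m, C, hsl⟩ := exists_isNearlyLinearOn hU hf hβ hβ1 hxU
    obtain ⟨ε, hε, hεs⟩ := Metric.nhds_basis_closedBall.mem_iff.1
      (Filter.inter_mem hs (hU.mem_nhds hxU))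
    obtain ⟨n, hn1, hn2⟩ := ((hlim.eventually (gt_mem_nhds hr)).and
      (hlim.eventually (gt_mem_nhds (half_pos hε)))).exists
    have hsub : (b n).ball ⊆ Metric.closedBall x ε := by
      refine Metric.closedBall_subset_closedBall' ?_
      have := hx n
      rw [BobMove.ball, Metric.mem_closedBall, dist_comm] at this
      linarith
    exact ⟨n, hn1.le, fun z hz => (hεs (hsub hz)).2, A, m, C,
      hsl.mono fun z hz => (hεs (hsub hz)).1⟩
  obtain ⟨t, htmono, hG0, ht⟩ := hσ b hb hlim hG
  set c := b (t 0)
  simp only [δ, dif_pos hG0] at ht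
  have hl := hlin c hG0
  have hCpos : 0 < C c hG0 := hl.pos.trans_le hl.le
  let b' : ℕ → BobMove d := fun j => (f (b (t j)).1, C c hG0 * (b (t j)).2)
  have hmem : ∀ j, (b (t j)).1 ∈ c.ball := fun j =>
    hb.ball_subset (htmono.monotone (Nat.zero_le j))
      (Metric.mem_closedBall_self (hb.radius_pos _).le)
  have hF : ∀ j, F.answer (b ∘ t) j =
      pull _ ((σ' c hG0).answer b' j) (A c hG0) (b (t j)).1 := by
    intro j
    exact dif_pos (c := G (b (t 0))) hG0
  have hlegal : ∀ j, LegalNext Set.univ (b' j) ((σ' c hG0).answer b' j) (b' (j + 1)) := by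
    intro j
    obtain ⟨h1, h2, h3⟩ := ht j
    refine hl.legalNext (hmem j) (hmem (j + 1)) hβ hβ1 (hb.radius_pos _) (hb.radius_pos _)
      (hb.dist_add_radius_le_of_le (htmono j.lt_succ_self).le) h1 h2 _
      (hP (A c hG0) (b (t j)).1 (f (b (t j)).1) _ _) ?_
    have h4 := hleg (t j) ((hb.radius_le (htmono.monotone (Nat.zero_le j))).trans hG0.1)
    rw [h3, hF] at h4
    exact notMem_thickening_iff.1 (Set.disjoint_left.1 h4 (hb.ball_subset
      (htmono j.lt_succ_self) (Metric.mem_closedBall_self (hb.radius_pos _).le)))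
  obtain ⟨s, hs, hsS⟩ := (hσ' c hG0).2 b' fun n =>
    ⟨⟨Set.mem_univ _, mul_pos hCpos (hb.radius_pos _)⟩, fun i _ => hlegal i⟩
  -- The point won in the image game and `f x` both lie in every image ball, and the radii tend to
  -- zero.
  have hsx : s = f x := by
    have h1 : ∀ j, dist s (f x) ≤ 2 * C c hG0 * (b (t j)).2 := by
      intro j
      have h2 : dist s (f (b (t j)).1) ≤ C c hG0 * (b (t j)).2 := Set.mem_iInter.1 hs j
      have h3 := hl.dist_le _ (hmem j) x (hx (t 0))
      have h4 : dist x (b (t j)).1 ≤ (b (t j)).2 := hx (t j)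
      rw [dist_comm (b (t j)).1 x] at h3
      have h5 := mul_le_mul_of_nonneg_left h4 hCpos.le
      have h6 := dist_triangle s (f (b (t j)).1) (f x)
      linarith
    have h2 : Tendsto (fun j => 2 * C c hG0 * (b (t j)).2) atTop (𝓝 0) := by
      simpa using (hlim.comp htmono.tendsto_atTop).const_mul (2 * C c hG0)
    exact dist_le_zero.1 (ge_of_tendsto' h2 h1)
  exact Or.inl ⟨hxU, show f x ∈ S from hsx ▸ hsS⟩

/-- By the chain rule the derivative of `g` is a left inverse of that of `f`, and an injective
endomorphism in finite dimension is invertible. -/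
theorem IsC1DiffeoOntoOpen.isNonsingularC1On
    {f : EuclideanSpace ℝ (Fin d) → EuclideanSpace ℝ (Fin d)}
    {U : Set (EuclideanSpace ℝ (Fin d))} (hU : IsOpen U) (hf : IsC1DiffeoOntoOpen f U) :
    IsNonsingularC1On f U := by
  obtain ⟨hf1, hfU, g, hg, hgf⟩ := hf
  refine ⟨hf1, fun x hx => ?_⟩
  have hdf : HasFDerivAt f (fderiv ℝ f x) x :=
    ((hf1.contDiffAt (hU.mem_nhds hx)).differentiableAt one_ne_zero).hasFDerivAt
  have hdg : HasFDerivAt g (fderiv ℝ g (f x)) (f x) :=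
    ((hg.contDiffAt (hfU.mem_nhds ⟨x, hx, rfl⟩)).differentiableAt one_ne_zero).hasFDerivAt
  have hid : HasFDerivAt (g ∘ f) (ContinuousLinearMap.id ℝ (EuclideanSpace ℝ (Fin d))) x :=
    (hasFDerivAt_id x).congr_of_eventuallyEq
      (Filter.eventuallyEq_of_mem (hU.mem_nhds hx) fun y hy => hgf hy)
  have hcomp := (hdg.comp x hdf).unique hid
  have hinj : Function.Injective (fderiv ℝ f x) :=
    Function.LeftInverse.injective (g := fderiv ℝ g (f x)) fun v => congrArg (fun l => l v) hcomp
  refine ⟨(LinearEquiv.ofInjectiveEndo (fderiv ℝ f x : _ →ₗ[ℝ] _)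
    hinj).toContinuousLinearEquiv, ?_⟩
  ext v
  rfl

/-! ### Hausdorff dimension of winning sets on diffuse sets -/

/-- The range of a coding by binary sequences whose cylinders of level `n` are separated by
`c * β ^ n` has positive Hausdorff dimension. -/
theorem dimH_range_pos_of_separated {X : Type*} [MetricSpace X] {π : (ℕ → Fin 2) → X} {c : ℝ}
    (hc : 0 < c) (hβ : 0 < β) (hβ1 : β < 1)
    (h : ∀ ω ω' n, (∀ i < n, ω i = ω' i) → ω n ≠ ω' n → c * β ^ n ≤ dist (π ω) (π ω')) :
    0 < dimH (Set.range π) := by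
  have hfirst : ∀ ω ω' : ℕ → Fin 2, ω ≠ ω' → ∃ n, (∀ i < n, ω i = ω' i) ∧ ω n ≠ ω' n := by
    intro ω ω' hne
    classical
    have hex := Function.ne_iff.1 hne
    exact ⟨Nat.find hex, fun i hi => not_not.1 (Nat.find_min hex hi), Nat.find_spec hex⟩
  have hinj : Function.Injective π := by
    intro ω ω' hπ
    by_contra hne
    obtain ⟨n, h1, h2⟩ := hfirst ω ω' hne
    have h3 := h ω ω' n h1 h2
    rw [hπ, dist_self] at h3
    have : 0 < c * β ^ n := by positivity
    linarith
  -- Reading the code of a point as binary digits maps the range onto `[0, 1]`. This map is Hölder,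
  -- so a range of dimension zero would force the interval to have dimension zero.
  let φ : X → ℝ := fun x => Real.ofDigits (Function.invFun π x)
  have hφ : ∀ ω, φ (π ω) = Real.ofDigits ω := fun ω => by
    simp only [φ, Function.leftInverse_invFun hinj ω]
  have hlog : Real.log β < 0 := Real.log_neg hβ hβ1
  -- The exponent solves `β ^ s = 1 / 2`, matching the separation `c * β ^ n` with binary intervals
  -- of length `2 ^ (-n)`.
  have hs : 0 < Real.log 2 / -Real.log β := div_pos (Real.log_pos one_lt_two) (neg_pos.2 hlog)
  let s : NNReal := ⟨Real.log 2 / -Real.log β, hs.le⟩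
  have hs0 : 0 < s := hs
  have hscoe : (s : ℝ) = Real.log 2 / -Real.log β := rfl
  have hβs : β ^ (s : ℝ) = 2⁻¹ := by
    rw [Real.rpow_def_of_pos hβ, hscoe]
    have : Real.log β * (Real.log 2 / -Real.log β) = -Real.log 2 := by
      field_simp [hlog.ne]
    rw [this, Real.exp_neg, Real.exp_log two_pos]
  have hC : 0 ≤ (c⁻¹) ^ (s : ℝ) := by positivity
  have hholder : HolderOnWith ((c⁻¹) ^ (s : ℝ)).toNNReal s φ (Set.range π) := by
    rintro _ ⟨ω, rfl⟩ _ ⟨ω', rfl⟩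
    rw [hφ, hφ]
    rcases eq_or_ne ω ω' with rfl | hne
    · simp
    obtain ⟨n, h1, h2⟩ := hfirst ω ω' hne
    have h3 := h ω ω' n h1 h2
    have h4 := Real.abs_ofDigits_sub_ofDigits_le h1
    rw [edist_dist, edist_dist, ENNReal.ofReal_rpow_of_nonneg dist_nonneg s.coe_nonneg,
      ← ENNReal.ofReal.eq_1, ← ENNReal.ofReal_mul hC]
    refine ENNReal.ofReal_le_ofReal ?_
    rw [Real.dist_eq]
    refine h4.trans ?_
    have h5 : (((2 : ℕ) : ℝ) ^ n)⁻¹ = (β ^ n) ^ (s : ℝ) := by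
      rw [← Real.rpow_natCast β n, ← Real.rpow_mul hβ.le, mul_comm, Real.rpow_mul hβ.le, hβs,
        Real.rpow_natCast, inv_pow]
      norm_num
    rw [h5, ← Real.mul_rpow (by positivity) dist_nonneg]
    refine Real.rpow_le_rpow (by positivity) ?_ s.coe_nonneg
    rwa [le_inv_mul_iff₀ hc]
  have himage : Set.Icc (0 : ℝ) 1 ⊆ φ '' Set.range π := by
    intro y hy
    obtain ⟨ω, -, hω⟩ := Real.ofDigits_SurjOn one_lt_two hy
    exact ⟨π ω, ⟨ω, rfl⟩, (hφ ω).trans hω⟩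
  have hdim : dimH (φ '' Set.range π) = 1 := by
    have := Real.dimH_of_nonempty_interior (E := ℝ) (s := φ '' Set.range π)
      (Set.Nonempty.mono (interior_mono himage) (by simp))
    simpa using this
  have hle := hholder.dimH_image_le hs0
  rw [hdim] at hle
  by_contra h0
  rw [not_lt, nonpos_iff_eq_zero] at h0
  rw [h0, ENNReal.zero_div] at hle
  exact absurd hle (by simp)

/-- The plays that arise when Bob answers by one of two moves at each step, depending on the
history of the play. -/
theorem exists_binary_tree (b₀ : BobMove d) (N : (ℕ → BobMove d) → ℕ → Fin 2 → BobMove d)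
    (hN : ∀ b b' n, (∀ i ≤ n, b i = b' i) → N b n = N b' n) :
    ∃ B : (ℕ → Fin 2) → ℕ → BobMove d, (∀ ω, B ω 0 = b₀) ∧
      (∀ ω n, B ω (n + 1) = N (B ω) n (ω n)) ∧
      ∀ ω ω' n, (∀ i < n, ω i = ω' i) → ∀ i ≤ n, B ω i = B ω' i := by
  -- `H ω n` is the whole history after `n` steps, padded by `b₀`; the play is its diagonal.
  let H : (ℕ → Fin 2) → ℕ → ℕ → BobMove d := fun ω n =>
    Nat.rec (fun _ => b₀) (fun n c => Function.update c (n + 1) (N c n (ω n))) n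
  have hHs : ∀ ω n, H ω (n + 1) = Function.update (H ω n) (n + 1) (N (H ω n) n (ω n)) :=
    fun _ _ => rfl
  have hHi : ∀ ω n i, i ≤ n → H ω n i = H ω i i := by
    intro ω n i hi
    induction n, hi using Nat.le_induction with
    | base => rfl
    | succ n hn ih => rw [hHs, Function.update_of_ne (by omega), ih]
  have hHω : ∀ ω ω' n, (∀ i < n, ω i = ω' i) → H ω n = H ω' n := by
    intro ω ω' n
    induction n with
    | zero => intro _; rfl
    | succ n ih =>
      intro h
      rw [hHs, hHs, ih fun i hi => h i (by omega), h n (by omega)]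
  refine ⟨fun ω n => H ω n n, fun ω => rfl, fun ω n => ?_, fun ω ω' n h i hi => ?_⟩
  · simp only
    rw [hHs, Function.update_self]
    exact congrFun (hN _ _ n (hHi ω n)) (ω n)
  · simp only
    rw [hHω ω ω' i fun j hj => h j (by omega)]

/-- Every binary sequence steers Bob through a legal play, whose limit point lies in `T` because the
strategy wins and in `K` because `K` is closed and contains the centres. -/
theorem dimH_inter_pos_of_winsSmall (hk : k < d) {K T : Set (EuclideanSpace ℝ (Fin d))} {γ : ℝ}
    (hγ : 0 < γ) (hγ1 : γ < 1) (hK : IsBetaDiffuse k γ K) {r : ℝ} (hβ : 0 < β)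
    (hβγ : β ≤ γ ^ 2 / 12) {σ : Strategy d k β} (hσ : σ.WinsSmall r T)
    {x : EuclideanSpace ℝ (Fin d)} (hx : x ∈ K) {ρ : ℝ} (hρ : 0 < ρ) :
    0 < dimH (T ∩ K ∩ Metric.closedBall x ρ) := by
  obtain ⟨ρK, hρK, hmove⟩ := exists_separated_legalNext hk hγ hγ1 hK
  have hβ1 : β < 1 := by nlinarith
  have hY : ∀ (b : BobMove d) (a : AliceMove d k β), ∃ y : Fin 2 → EuclideanSpace ℝ (Fin d),
      b.1 ∈ K → 0 < b.2 → b.2 ≤ ρK → (∀ i, LegalNext K b a (y i, β * b.2)) ∧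
          ∀ i j, i ≠ j → 3 * β * b.2 ≤ dist (y i) (y j) := by
    intro b a
    by_cases h : b.1 ∈ K ∧ 0 < b.2 ∧ b.2 ≤ ρK
    · obtain ⟨y, hy⟩ := hmove β hβ hβγ b h.1 h.2.1 h.2.2 a
      exact ⟨y, fun _ _ _ => hy⟩
    · exact ⟨fun _ => 0, fun h1 h2 h3 => absurd ⟨h1, h2, h3⟩ h⟩
  choose Y hY using hY
  set ρ₀ := min ρ ρK
  have hρ₀pos : 0 < ρ₀ := lt_min hρ hρK
  obtain ⟨B, hB0, hBs, hBω⟩ := exists_binary_tree (x, ρ₀)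
    (fun b n e => (Y (b n) (σ.answer b n) e, β * (b n).2)) (fun b b' n h => by
      rw [h n le_rfl, σ.answer_congr h])
  have hrad : ∀ ω n, (B ω n).2 = β ^ n * ρ₀ := by
    intro ω n
    induction n with
    | zero => simp [hB0]
    | succ n ih => rw [hBs, pow_succ', mul_assoc, ← ih]
  have hpos : ∀ ω n, 0 < (B ω n).2 := fun ω n => by rw [hrad]; positivity
  have hle : ∀ ω n, (B ω n).2 ≤ ρ₀ := fun ω n => by
    rw [hrad]
    exact mul_le_of_le_one_left hρ₀pos.le (pow_le_one₀ hβ.le hβ1.le)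
  have hBK : ∀ ω n, (B ω n).1 ∈ K := by
    intro ω n
    induction n with
    | zero => rw [hB0]; exact hx
    | succ n ih =>
      rw [hBs]
      exact ((hY (B ω n) (σ.answer (B ω) n) ih (hpos ω n)
        ((hle ω n).trans (min_le_right _ _))).1 (ω n)).1
  have hmv : ∀ ω n, _ := fun ω n => hY (B ω n) (σ.answer (B ω) n) (hBK ω n) (hpos ω n)
    ((hle ω n).trans (min_le_right _ _))
  have hlegal : ∀ ω n, LegalNext K (B ω n) (σ.answer (B ω) n) (B ω (n + 1)) := by
    intro ω n
    rw [hBs]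
    exact (hmv ω n).1 (ω n)
  have hplay : ∀ ω, IsPlay β (B ω) := fun ω => ⟨hpos ω, fun n => (hlegal ω n).2.2.1, fun n =>
    dist_add_le_of_closedBall_subset (by omega) (hpos ω (n + 1)).le
      ((hlegal ω n).2.2.2.trans Set.sdiff_subset)⟩
  have hlim : ∀ ω, Tendsto (fun n => (B ω n).2) atTop (𝓝 0) := by
    intro ω
    simp only [hrad]
    simpa using (tendsto_pow_atTop_nhds_zero_of_lt_one hβ.le hβ1).mul_const ρ₀
  choose π hπ using fun ω => (hplay ω).exists_closedBall_subset fun n => (hpos ω n).le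
  have hπ' : ∀ ω n, dist (π ω) (B ω n).1 ≤ (B ω n).2 := fun ω n =>
    hπ ω n (Metric.mem_closedBall_self le_rfl)
  have hsub : Set.range π ⊆ T ∩ K ∩ Metric.closedBall x ρ := by
    rintro _ ⟨ω, rfl⟩
    refine ⟨⟨?_, ?_⟩, ?_⟩
    · refine hσ (B ω) (hplay ω) (hlim ω) (fun n _ => ?_) (π ω) (hπ' ω)
      exact (Set.subset_sdiff.1 (hlegal ω n).2.2.2).2
    · refine hK.1.mem_of_tendsto (b := atTop) (f := fun n => (B ω n).1) ?_
        (Eventually.of_forall (hBK ω))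
      rw [tendsto_iff_dist_tendsto_zero]
      refine squeeze_zero (fun _ => dist_nonneg) (fun n => ?_) (hlim ω)
      rw [dist_comm]
      exact hπ' ω n
    · have := hπ' ω 0
      rw [hB0] at this
      exact this.trans (min_le_left _ _)
  refine lt_of_lt_of_le ?_ (dimH_mono hsub)
  -- At the first differing digit the new centres are at least `3 * β * (β ^ n * ρ₀)` apart; each
  -- limit point is within a third of this of its centre, leaving `β * ρ₀ * β ^ n`.
  refine dimH_range_pos_of_separated (c := β * ρ₀) (by positivity) hβ hβ1 fun ω ω' n h hn => ?_
  have hagree := hBω ω ω' n h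
  have h1 := hπ' ω (n + 1)
  have h2 := hπ' ω' (n + 1)
  have h3 := (hmv ω n).2 (ω n) (ω' n) hn
  have h4 : (B ω (n + 1)).1 = Y (B ω n) (σ.answer (B ω) n) (ω n) := by rw [hBs]
  have h5 : (B ω' (n + 1)).1 = Y (B ω n) (σ.answer (B ω) n) (ω' n) := by
    rw [hBs, σ.answer_congr hagree, hagree n le_rfl]
  rw [← h4, ← h5, hrad] at h3
  rw [hrad, pow_succ] at h1 h2
  have h6 := dist_triangle4 (B ω (n + 1)).1 (π ω) (π ω') (B ω' (n + 1)).1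
  rw [dist_comm (B ω (n + 1)).1 (π ω)] at h6
  linarith

/-! ### From shrinking plays to the full game. -/

/-- On a diffuse set, a dense target that can be won against shrinking plays is winning. -/
theorem isBetaWinningOn_of_winsSmall (hk : k < d) {K T : Set (EuclideanSpace ℝ (Fin d))} {γ : ℝ}
    (hγ : 0 < γ) (hγ1 : γ < 1) (hK : IsBetaDiffuse k γ K) (hβ : 0 < β) (hβγ : β ≤ γ ^ 2 / 12)
    (hT : Dense T) (h : ∀ r : ℝ, 0 < r → ∃ σ : Strategy d k β, σ.WinsSmall r T) :
    IsBetaWinningOn k β T K := by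
  obtain ⟨ρK, hρK, hmove⟩ := exists_separated_legalNext hk hγ hγ1 hK
  have hβ1 : β < 1 := by nlinarith
  obtain ⟨σ, hσ⟩ := h ρK hρK
  choose far hfar using fun (b : BobMove d) (hb : 0 < b.2) =>
    exists_aliceMove_disjoint (k := k) hk hβ hβ1 b hb
  -- Diffuseness says nothing above the scale `ρK`, so there Alice must not risk blocking Bob and
  -- plays away from his ball.
  let α : (ℕ → BobMove d) → ℕ → AliceMove d k β := fun b n =>
    if hb : ρK < (b n).2 then far (b n) (hρK.trans hb) else σ.answer b n
  have hα : ∀ b n, (Strategy.ofRule α).answer b n = α b n := by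
    refine Strategy.answer_ofRule fun b b' n hbb => ?_
    simp only [α, hbb n le_rfl, σ.answer_congr hbb]
  refine ⟨Strategy.ofRule α, fun b n hleg => ?_, fun b hleg => ?_⟩
  · have hbn : (b n).1 ∈ K ∧ 0 < (b n).2 := by
      rcases n with _ | n
      · exact hleg.1
      · exact ⟨(hleg.2 n n.lt_succ_self).1, (hleg.2 n n.lt_succ_self).2.1⟩
    by_cases hb : ρK < (b n).2
    · refine ⟨((b n).1, β * (b n).2), hbn.1, mul_pos hβ hbn.2, le_rfl, ?_⟩
      have h1 : BobMove.ball ((b n).1, β * (b n).2) ⊆ (b n).ball :=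
        Metric.closedBall_subset_closedBall (mul_le_of_le_one_left hbn.2.le hβ1.le)
      rw [hα]
      simp only [α, dif_pos hb]
      exact Set.subset_sdiff.2 ⟨h1, (hfar _ _).mono_left h1⟩
    · obtain ⟨y, hy, -⟩ := hmove β hβ hβγ (b n) hbn.1 hbn.2 (not_lt.1 hb)
        ((Strategy.ofRule α).answer b n)
      exact ⟨_, hy 0⟩
  · have hnext : ∀ n, LegalNext K (b n) ((Strategy.ofRule α).answer b n) (b (n + 1)) :=
      fun n => (hleg (n + 1)).2 n n.lt_succ_self
    have hpos : ∀ n, 0 < (b n).2 := by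
      rintro (_ | n)
      · exact (hleg 0).1.2
      · exact (hnext n).2.1
    have hplay : IsPlay β b := ⟨hpos, fun n => (hnext n).2.2.1, fun n =>
      dist_add_le_of_closedBall_subset (by omega) (hpos (n + 1)).le
        ((hnext n).2.2.2.trans Set.sdiff_subset)⟩
    by_cases hlim : Tendsto (fun n => (b n).2) atTop (𝓝 0)
    · obtain ⟨y, hy⟩ := hplay.exists_closedBall_subset fun n => (hpos n).le
      have hy' : ∀ n, y ∈ (b n).ball := fun n => hy n (Metric.mem_closedBall_self le_rfl)
      refine ⟨y, Set.mem_iInter.2 hy', hσ b hplay hlim (fun n hn => ?_) y hy'⟩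
      have h1 := (Set.subset_sdiff.1 (hnext n).2.2.2).2
      rw [hα] at h1
      simpa only [α, dif_neg (not_lt.2 hn)] using h1
    -- Radii not tending to zero are bounded below, so Bob's balls share a ball of positive radius,
    -- which the dense set `T` meets.
    · obtain ⟨c, hc, hcb⟩ : ∃ c, 0 < c ∧ ∀ n, c ≤ (b n).2 := by
        by_contra hcon
        push Not at hcon
        refine hlim (Metric.tendsto_atTop.2 fun ε hε => ?_)
        obtain ⟨N, hN⟩ := hcon ε hε
        refine ⟨N, fun n hn => ?_⟩
        rw [Real.dist_0_eq_abs, abs_of_pos (hpos n)]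
        exact (hplay.radius_le hn).trans_lt hN
      obtain ⟨y, hy⟩ := hplay.exists_closedBall_subset hcb
      obtain ⟨z, hz, hzT⟩ := hT.exists_mem_open Metric.isOpen_ball
        ⟨y, Metric.mem_ball_self (x := y) hc⟩
      exact ⟨z, Set.mem_iInter.2 fun n => hy n (Metric.ball_subset_closedBall hzT), hz⟩

/-- A target that can be won against shrinking plays is dense. -/
theorem dense_of_winsSmall (hk : k < d) {T : Set (EuclideanSpace ℝ (Fin d))} {r : ℝ}
    (h : ∀ β : ℝ, 0 < β → β < 1 → ∃ σ : Strategy d k β, σ.WinsSmall r T) : Dense T := by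
  obtain ⟨σ, hσ⟩ := h (1 / 48) (by norm_num) (by norm_num)
  refine dense_iff_inter_open.2 fun V hV ⟨x, hx⟩ => ?_
  -- The whole space is diffuse with `γ = 1 / 2`, and `γ ^ 2 / 12 = 1 / 48`.
  obtain ⟨ε, hε, hεV⟩ := Metric.nhds_basis_closedBall.mem_iff.1 (hV.mem_nhds hx)
  have hdim := dimH_inter_pos_of_winsSmall hk (by norm_num) (by norm_num) (isBetaDiffuse_univ hk)
    (by norm_num) (by norm_num) hσ (Set.mem_univ x) hε
  have hne : (T ∩ Set.univ ∩ Metric.closedBall x ε).Nonempty := by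
    rw [Set.nonempty_iff_ne_empty]
    intro h0
    rw [h0, dimH_empty] at hdim
    exact lt_irrefl _ hdim
  obtain ⟨z, ⟨hzT, -⟩, hz⟩ := hne
  exact ⟨z, hεV hz, hzT⟩

end AbsoluteGame

/-! ### The main theorem. -/

theorem theorem4p10 {d k : ℕ} (hk : k < d)
    (S U K : Set (EuclideanSpace ℝ (Fin d)))
    (hS : AbsoluteGame.IsAbsoluteWinning k S) (hU : IsOpen U)
    (hK : AbsoluteGame.IsDiffuse k K) :
    (∀ f : EuclideanSpace ℝ (Fin d) → EuclideanSpace ℝ (Fin d),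
      AbsoluteGame.IsNonsingularC1On f U →
        AbsoluteGame.IsAbsoluteWinningOn k ((U ∩ f ⁻¹' S) ∪ Uᶜ) K) ∧
    ((U ∩ K).Nonempty →
      ∀ f : ℕ → EuclideanSpace ℝ (Fin d) → EuclideanSpace ℝ (Fin d),
        (∀ i, AbsoluteGame.IsC1DiffeoOntoOpen (f i) U) →
          0 < dimH ((⋂ i, U ∩ f i ⁻¹' S) ∩ K)) := by
  obtain ⟨γ, hγ, hγ1, hdiff⟩ := hK
  refine ⟨fun f hf => ⟨γ ^ 2 / 12, by positivity, fun β hβ hβγ => ?_⟩, ?_⟩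
  · have hβ1 : β < 1 := by nlinarith
    refine AbsoluteGame.isBetaWinningOn_of_winsSmall hk hγ hγ1 hdiff hβ hβγ ?_ fun r hr =>
      AbsoluteGame.exists_winsSmall_preimage hk hS hU hf hr hβ hβ1
    exact AbsoluteGame.dense_of_winsSmall hk fun β' hβ' hβ1' =>
      AbsoluteGame.exists_winsSmall_preimage hk hS hU hf one_pos hβ' hβ1'
  · rintro ⟨x, hxU, hxK⟩ f hf
    have hβ : 0 < γ ^ 2 / 12 := by positivity
    obtain ⟨σ, hσ⟩ := AbsoluteGame.exists_winsSmall_iInter (k := k)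
      (T := fun i => (U ∩ f i ⁻¹' S) ∪ Uᶜ)
      (fun i β' hβ' hβ1' => AbsoluteGame.exists_winsSmall_preimage hk hS hU
        ((hf i).isNonsingularC1On hU) one_pos hβ' hβ1') hβ (by nlinarith)
    -- The Cantor set is built in a ball contained in `U`, where the alternative `Uᶜ` in the targets
    -- cannot occur.
    obtain ⟨ε, hε, hεU⟩ := Metric.nhds_basis_closedBall.mem_iff.1 (hU.mem_nhds hxU)
    refine lt_of_lt_of_le (AbsoluteGame.dimH_inter_pos_of_winsSmall hk hγ hγ1 hdiff hβ le_rfl hσ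
      hxK hε) (dimH_mono ?_)
    rintro z ⟨⟨hzT, hzK⟩, hz⟩
    refine ⟨Set.mem_iInter.2 fun i => ?_, hzK⟩
    exact (Set.mem_iInter.1 hzT i).resolve_right fun h => h (hεU hz)
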